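/- Let $n\ge 1$ be an integer, let $c=\frac14\left(1-\frac1{(2n+1)^2}\right)$, and let $b\in\mathbb C$, $b\neq 0$. Put $\delta=-\frac1{2n+1}$ (so that $\delta^2=1-4c$), $v_1=\frac{-1+\delta}{2c}=-\frac{2n+1}{n}$ and $v_2=\frac{-1-\delta}{2c}=-\frac{2n+1}{n+1}$. Consider in the complex domain the differential equation $$y'=cxy^3+y^2. \qquad (*)$$ Then the equation $$\left(1-\frac{b y_0}{v_1}\right)^n=\left(1-\frac{b y_0}{v_2}\right)^{n+1}$$ has exactly $n$ distinct nonzero complex roots $y_0^1,\dots,y_0^n$. For each $j=1,\dots,n$ there are a local (holomorphic) solution $y^j$ of $(*)$ at the origin with $y^j(0)=y_0^j$ and a continuous path $s^j$ in $\mathbb C$ from $0$ to $b$ such that $y^j$ can be analytically continued along $s^j$ and the continuation takes at $b$ the value $y_0^j$. That is, $(*)$ has $n$ different complex "limit cycles" $y(0)=y(b)$. Conversely, if a local solution $y$ of $(*)$ at the origin with $y(0)\neq0$ can be analytically continued along some path from $0$ to $b$ so that the continuation takes at $b$ the value $y(0)$, then $y(0)$ is one of $y_0^1,\dots,y_0^n$.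 -/

import Mathlib

open Topology

/-- `y` is a local solution at the point `a` of the complex differential equation
`y' = c x y³ + y²`: the equation holds at every point of some neighbourhood of `a`
(so `y` is holomorphic near `a`). -/
def IsLocalSolution (c a : ℂ) (y : ℂ → ℂ) : Prop :=
  ∀ᶠ x in 𝓝 a, HasDerivAt y (c * x * y x ^ 3 + y x ^ 2) x

/-- `F` is an analytic continuation along the path `s` of the germ of `y` at the starting
point `p`: every `F t` is (a representative of) an analytic germ at `s t`, the germ of `F 0`
is that of `y`, and for `t'` close to `t` the germ of `F t'` at `s t'` is the one determined
by `F t`. -/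
structure IsContinuationAlong {p q : ℂ} (y : ℂ → ℂ) (s : Path p q)
    (F : unitInterval → ℂ → ℂ) : Prop where
  analytic : ∀ t, AnalyticAt ℂ (F t) (s t)
  start : F 0 =ᶠ[𝓝 p] y
  coherent : ∀ t, ∀ᶠ t' in 𝓝 t, F t' =ᶠ[𝓝 (s t')] F t

/-- The germ of `y` at `p` can be analytically continued along the path `s` from `p` to `q`,
and the continuation takes at `q` the same value as `y` takes at `p`. -/
def ClosesAlong {p q : ℂ} (y : ℂ → ℂ) (s : Path p q) : Prop :=
  ∃ F : unitInterval → ℂ → ℂ, IsContinuationAlong y s F ∧ F 1 q = y p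

/-- The coefficient `c = (1/4) (1 - 1/(2n+1)²)`. -/
noncomputable def abelC (n : ℕ) : ℂ := 1 / 4 * (1 - 1 / (2 * n + 1) ^ 2)

/-- The square root `δ = -1/(2n+1)` of `1 - 4c`. -/
noncomputable def abelDelta (n : ℕ) : ℂ := -(1 / (2 * n + 1))

/-- The root `v₁ = (-1 + δ)/(2c)` of `c v² + v + 1`. -/
noncomputable def abelV₁ (n : ℕ) : ℂ := (-1 + abelDelta n) / (2 * abelC n)

/-- The root `v₂ = (-1 - δ)/(2c)` of `c v² + v + 1`. -/
noncomputable def abelV₂ (n : ℕ) : ℂ := (-1 - abelDelta n) / (2 * abelC n)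

/-!
Put `v = x y`, and let `a = 1 - v / v₁`, `d = 1 - v / v₂` be the two linear factors of
`1 + v + c v²`. Along a solution `v' = y a d`, and for the given value of `c` the partial
fraction expansion of `(1 + c v) / (a d)` has integer residues, so the first integral
`y aⁿ / dⁿ⁺¹` is a rational function.

*Closed solutions satisfy the equation.* Near the origin `y aⁿ = y(0) dⁿ⁺¹`
(`IsLocalSolution.first_integral`). This relation is analytic, so it persists under analytic
continuation along any path (`IsContinuationAlong.eventually_eq_zero`); evaluating it at `b`,
where the continuation equals `y(0) ≠ 0`, gives `aⁿ = dⁿ⁺¹` at `v = b y(0)`.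

*Roots give closed solutions.* The solution curve through `(0, z)` is rationally parametrized by
`v`, as `y = z dⁿ⁺¹ / aⁿ` and `x = v / y`, with `dx/dv = 1 / (y a d)`. A path in the `v`-plane
from `0` to `b z` that avoids the zeros of `a` and `d` therefore lifts to germs of solutions that
continue each other (`exists_germs_of_parametrization`). It exists because the complement of a
finite set is path connected, and if `aⁿ = dⁿ⁺¹` at `v = b z`, its end is the point `(b, z)`.

*Counting.* The equation is polynomial of degree `n + 1` in `z`, with `0` as a root. Since
`(n + 1) a - n d = 1`, a double root would have `|a| < 1 < |d|`, which is impossible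
(`not_isRoot_derivative_closingPolynomial`). Hence there are exactly `n` nonzero roots.
-/

open Filter Polynomial

/-! ### The coefficients -/

/-- The linear factor `1 - v / v₁` of `1 + v + c v²`. -/
noncomputable def firstFactor (n : ℕ) (v : ℂ) : ℂ := 1 - v / abelV₁ n

/-- The linear factor `1 - v / v₂` of `1 + v + c v²`. -/
noncomputable def secondFactor (n : ℕ) (v : ℂ) : ℂ := 1 - v / abelV₂ n

lemma two_mul_natCast_add_one_ne_zero (n : ℕ) : (2 * n + 1 : ℂ) ≠ 0 := by
  exact_mod_cast Nat.succ_ne_zero (2 * n)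

lemma abelC_eq (n : ℕ) : abelC n = n * (n + 1) / (2 * n + 1) ^ 2 := by
  have h := two_mul_natCast_add_one_ne_zero n
  unfold abelC
  field_simp
  ring

lemma firstFactor_eq {n : ℕ} (hn : 1 ≤ n) (v : ℂ) :
    firstFactor n v = 1 + n / (2 * n + 1) * v := by
  have h := two_mul_natCast_add_one_ne_zero n
  have h0 : (n : ℂ) ≠ 0 := by exact_mod_cast (by omega : n ≠ 0)
  have h1 : (n + 1 : ℂ) ≠ 0 := by exact_mod_cast Nat.succ_ne_zero n
  have hV : abelV₁ n = -(2 * n + 1) / n := by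
    unfold abelV₁ abelDelta
    rw [abelC_eq]
    field_simp
    ring
  rw [firstFactor, hV]
  field_simp
  ring

lemma secondFactor_eq {n : ℕ} (hn : 1 ≤ n) (v : ℂ) :
    secondFactor n v = 1 + (n + 1) / (2 * n + 1) * v := by
  have h := two_mul_natCast_add_one_ne_zero n
  have h0 : (n : ℂ) ≠ 0 := by exact_mod_cast (by omega : n ≠ 0)
  have h1 : (n + 1 : ℂ) ≠ 0 := by exact_mod_cast Nat.succ_ne_zero n
  have hV : abelV₂ n = -(2 * n + 1) / (n + 1) := by
    unfold abelV₂ abelDelta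
    rw [abelC_eq]
    field_simp
    ring
  rw [secondFactor, hV]
  field_simp
  ring

/-- The two factors have no common zero. -/
lemma firstFactor_secondFactor_relation {n : ℕ} (hn : 1 ≤ n) (v : ℂ) :
    (n + 1) * firstFactor n v - n * secondFactor n v = 1 := by
  rw [firstFactor_eq hn, secondFactor_eq hn]
  ring

lemma firstFactor_mul_secondFactor {n : ℕ} (hn : 1 ≤ n) (v : ℂ) :
    firstFactor n v * secondFactor n v = 1 + v + abelC n * v ^ 2 := by
  rw [firstFactor_eq hn, secondFactor_eq hn, abelC_eq]
  have h := two_mul_natCast_add_one_ne_zero n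
  generalize hM : (2 * n + 1 : ℂ) = M at *
  field_simp
  rw [← hM]
  ring

/-- Partial fractions: after division by `a d` the residues yield the exponents of the first
integral. -/
lemma abelC_mul_add_one {n : ℕ} (hn : 1 ≤ n) (v : ℂ) :
    abelC n * v + 1 = (n + 1) ^ 2 / (2 * n + 1) * firstFactor n v -
      n ^ 2 / (2 * n + 1) * secondFactor n v := by
  rw [firstFactor_eq hn, secondFactor_eq hn, abelC_eq]
  have h := two_mul_natCast_add_one_ne_zero n
  generalize hM : (2 * n + 1 : ℂ) = M at *
  field_simp
  rw [← hM]
  ring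

lemma firstFactor_zero (n : ℕ) : firstFactor n 0 = 1 := by simp [firstFactor]

lemma secondFactor_zero (n : ℕ) : secondFactor n 0 = 1 := by simp [secondFactor]

lemma hasDerivAt_firstFactor {n : ℕ} (hn : 1 ≤ n) (v : ℂ) :
    HasDerivAt (firstFactor n) (n / (2 * n + 1)) v := by
  rw [show firstFactor n = fun v : ℂ => 1 + n / (2 * n + 1) * v from funext (firstFactor_eq hn)]
  simpa using ((hasDerivAt_id v).const_mul (n / (2 * n + 1) : ℂ)).const_add 1

lemma hasDerivAt_secondFactor {n : ℕ} (hn : 1 ≤ n) (v : ℂ) :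
    HasDerivAt (secondFactor n) ((n + 1) / (2 * n + 1)) v := by
  rw [show secondFactor n = fun v : ℂ => 1 + (n + 1) / (2 * n + 1) * v from
    funext (secondFactor_eq hn)]
  simpa using ((hasDerivAt_id v).const_mul ((n + 1) / (2 * n + 1) : ℂ)).const_add 1

lemma analyticAt_firstFactor (n : ℕ) (v : ℂ) : AnalyticAt ℂ (firstFactor n) v := by
  unfold firstFactor
  simp only [div_eq_mul_inv]
  fun_prop

lemma analyticAt_secondFactor (n : ℕ) (v : ℂ) : AnalyticAt ℂ (secondFactor n) v := by
  unfold secondFactor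
  simp only [div_eq_mul_inv]
  fun_prop

/-- At a solution of `a ^ n = d ^ (n + 1)` neither factor vanishes: if one did, so would the
other. -/
lemma factors_ne_zero_of_pow_eq {n : ℕ} (hn : 1 ≤ n) {v : ℂ}
    (h : firstFactor n v ^ n = secondFactor n v ^ (n + 1)) :
    firstFactor n v ≠ 0 ∧ secondFactor n v ≠ 0 := by
  have hr := firstFactor_secondFactor_relation hn v
  have hn0 : n ≠ 0 := by omega
  constructor <;> intro h0
  · rw [h0, zero_pow hn0] at h
    have := eq_zero_of_pow_eq_zero h.symm
    simp [h0, this] at hr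
  · rw [h0, zero_pow n.succ_ne_zero] at h
    have := eq_zero_of_pow_eq_zero h
    simp [h0, this] at hr

/-! ### The first integral -/

/-- Uniqueness for an analytic scalar linear homogeneous equation: a solution vanishing at a
point vanishes near it, because differentiation lowers a finite order of vanishing. -/
lemma eventually_eq_zero_of_hasDerivAt_mul {P g : ℂ → ℂ} {p : ℂ} (hg : AnalyticAt ℂ g p)
    (hP : ∀ᶠ x in 𝓝 p, HasDerivAt P (g x * P x) x) (h0 : P p = 0) :
    ∀ᶠ x in 𝓝 p, P x = 0 := by
  have hPa : AnalyticAt ℂ P p :=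
    Complex.analyticAt_iff_eventually_differentiableAt.2 (hP.mono fun x hx => hx.differentiableAt)
  have hd : deriv P =ᶠ[𝓝 p] g * P := hP.mono fun x hx => hx.deriv
  have ho := hPa.analyticOrderAt_deriv_add_one
  rw [analyticOrderAt_congr hd, analyticOrderAt_mul hg hPa] at ho
  simp only [h0, sub_zero] at ho
  rw [← analyticOrderAt_eq_top]
  by_contra hne
  obtain ⟨m, hm⟩ := ENat.ne_top_iff_exists.1 hne
  rw [← hm] at ho
  cases hk : analyticOrderAt g p with
  | top => simp [hk] at ho
  | coe k =>
    rw [hk] at ho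
    norm_cast at ho
    omega

/-- With `a`, `d` the two linear factors evaluated at `x y`, both `y aⁿ` and `dⁿ⁺¹` solve the
equation `w' = (n + 1)² / (2 n + 1) · y a w` along a solution `y`, so they stay proportional. -/
lemma IsLocalSolution.first_integral {n : ℕ} (hn : 1 ≤ n) {y : ℂ → ℂ}
    (hy : IsLocalSolution (abelC n) 0 y) :
    ∀ᶠ x in 𝓝 0, y x * firstFactor n (x * y x) ^ n = y 0 * secondFactor n (x * y x) ^ (n + 1) := by
  have hya : AnalyticAt ℂ y 0 :=
    Complex.analyticAt_iff_eventually_differentiableAt.2 (hy.mono fun x hx => hx.differentiableAt)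
  have hfa : AnalyticAt ℂ (fun x => firstFactor n (x * y x)) 0 :=
    (analyticAt_firstFactor n _).comp (analyticAt_id.mul hya)
  have hg : AnalyticAt ℂ
      (fun x => (n + 1) ^ 2 / (2 * n + 1) * (y x * firstFactor n (x * y x))) 0 :=
    analyticAt_const.mul (hya.mul hfa)
  have key := eventually_eq_zero_of_hasDerivAt_mul (P := fun x =>
    y x * firstFactor n (x * y x) ^ n - y 0 * secondFactor n (x * y x) ^ (n + 1)) hg
    (hy.mono fun x hx => ?_) (by simp [firstFactor_zero, secondFactor_zero])
  · exact key.mono fun x hx => sub_eq_zero.1 hx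
  · have hv := (hasDerivAt_id x).mul hx
    have hA := (hasDerivAt_firstFactor hn (x * y x)).comp x hv
    have hD := (hasDerivAt_secondFactor hn (x * y x)).comp x hv
    have h := (hx.mul (hA.pow n)).sub ((hD.pow (n + 1)).const_mul (y 0))
    refine h.congr_deriv ?_
    have e1 : 1 * y x + x * (abelC n * x * y x ^ 3 + y x ^ 2)
        = y x * (firstFactor n (x * y x) * secondFactor n (x * y x)) := by
      rw [firstFactor_mul_secondFactor hn]; ring
    have e2 : abelC n * x * y x ^ 3 + y x ^ 2 = y x ^ 2 * (abelC n * (x * y x) + 1) := by ring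
    simp only [Function.comp_apply, id, Pi.mul_apply, Pi.pow_apply]
    rw [e1, e2, abelC_mul_add_one hn]
    obtain ⟨m, rfl⟩ : ∃ m, n = m + 1 := ⟨n - 1, by omega⟩
    rw [Nat.cast_succ (m + 1)]
    simp only [Nat.add_sub_cancel]
    ring

/-- An analytic relation between a germ and the variable persists under continuation along a
path. The relation is `R f = 0`, where `R` acts on the values of `f` pointwise and preserves
analyticity; by the identity theorem the parameters at which it holds form a clopen set. -/
lemma IsContinuationAlong.eventually_eq_zero {p q : ℂ} {y : ℂ → ℂ} {s : Path p q}
    {F : unitInterval → ℂ → ℂ} (hF : IsContinuationAlong y s F) {R : (ℂ → ℂ) → ℂ → ℂ}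
    (hloc : ∀ f g : ℂ → ℂ, ∀ x, f x = g x → R f x = R g x)
    (han : ∀ f : ℂ → ℂ, ∀ x, AnalyticAt ℂ f x → AnalyticAt ℂ (R f) x)
    (h0 : ∀ᶠ x in 𝓝 p, R y x = 0) (t : unitInterval) :
    ∀ᶠ x in 𝓝 (s t), R (F t) x = 0 := by
  have hiff : ∀ t, ∀ᶠ t' in 𝓝 t,
      ((∀ᶠ x in 𝓝 (s t'), R (F t') x = 0) ↔ ∀ᶠ x in 𝓝 (s t), R (F t) x = 0) := by
    intro t
    obtain ⟨r, hr, hball⟩ := Metric.eventually_nhds_iff_ball.1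
      (han _ _ (hF.analytic t)).eventually_analyticAt
    have hs : ∀ᶠ t' in 𝓝 t, s t' ∈ Metric.ball (s t) r :=
      s.continuous.continuousAt.eventually (Metric.ball_mem_nhds _ hr)
    filter_upwards [hF.coherent t, hs] with t' hc ht'
    have hcR : ∀ᶠ x in 𝓝 (s t'), R (F t') x = R (F t) x := hc.mono fun x hx => hloc _ _ x hx
    have hid : ∀ u ∈ Metric.ball (s t) r, ∀ w ∈ Metric.ball (s t) r,
        (∀ᶠ x in 𝓝 u, R (F t) x = 0) → ∀ᶠ x in 𝓝 w, R (F t) x = 0 := by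
      intro u hu w hw h
      have := AnalyticOnNhd.eqOn_zero_of_preconnected_of_eventuallyEq_zero
        (f := R (F t)) (U := Metric.ball (s t) r) (fun x hx => hball x hx)
        (convex_ball _ _).isPreconnected hu h
      exact Filter.mem_of_superset (Metric.isOpen_ball.mem_nhds hw) this
    constructor
    · intro h
      refine hid _ ht' _ (Metric.mem_ball_self hr) ?_
      filter_upwards [h, hcR] with x h1 h2
      rw [← h2, h1]
    · intro h
      filter_upwards [hid _ (Metric.mem_ball_self hr) _ ht' h, hcR] with x h1 h2
      rw [h2, h1]
  have hclopen : IsClopen {t | ∀ᶠ x in 𝓝 (s t), R (F t) x = 0} := by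
    constructor
    · rw [← isOpen_compl_iff, isOpen_iff_mem_nhds]
      intro t ht
      exact (hiff t).mono fun t' h' h => ht (h'.1 h)
    · rw [isOpen_iff_mem_nhds]
      intro t ht
      exact (hiff t).mono fun t' h' => h'.2 ht
  have hne : (0 : unitInterval) ∈ {t | ∀ᶠ x in 𝓝 (s t), R (F t) x = 0} := by
    have hst := hF.start
    simp only [Set.mem_ofPred_eq, s.source]
    filter_upwards [h0, hst] with x h1 h2
    rw [hloc _ _ x h2, h1]
  exact (hclopen.eq_univ ⟨0, hne⟩ ▸ Set.mem_univ t :)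

lemma pow_eq_of_closesAlong {n : ℕ} (hn : 1 ≤ n) {b : ℂ} {y : ℂ → ℂ} {s : Path (0 : ℂ) b}
    (hy : IsLocalSolution (abelC n) 0 y) (hc : ClosesAlong y s) (h0 : y 0 ≠ 0) :
    firstFactor n (b * y 0) ^ n = secondFactor n (b * y 0) ^ (n + 1) := by
  obtain ⟨F, hF, hF1⟩ := hc
  have h := hF.eventually_eq_zero
    (R := fun f x => f x * firstFactor n (x * f x) ^ n - y 0 * secondFactor n (x * f x) ^ (n + 1))
    (fun f g x hx => by simp only [hx])
    (fun f x hf => (hf.mul (((analyticAt_firstFactor n _).comp (analyticAt_id.mul hf)).pow n)).sub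
      (analyticAt_const.mul
        (((analyticAt_secondFactor n _).comp (analyticAt_id.mul hf)).pow (n + 1))))
    ((hy.first_integral hn).mono fun x hx => sub_eq_zero.2 hx) 1
  have h1 := h.self_of_nhds
  rw [s.target, hF1, ← mul_sub] at h1
  exact sub_eq_zero.1 ((mul_eq_zero.1 h1).resolve_left h0)

/-! ### Continuation of a parametrized curve -/

/-- A curve `v ↦ (X v, Y v)` with `X' ≠ 0` along a path `γ` defines, through the local inverses
of `X`, germs `Y ∘ X⁻¹` at the points `X (γ t)` which continue each other analytically. -/
lemma exists_germs_of_parametrization {u w : ℂ} (γ : Path u w) {X Y : ℂ → ℂ}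
    (hX : ∀ t, AnalyticAt ℂ X (γ t)) (hX' : ∀ t, deriv X (γ t) ≠ 0)
    (hY : ∀ t, AnalyticAt ℂ Y (γ t)) :
    ∃ F : unitInterval → ℂ → ℂ, (∀ t, AnalyticAt ℂ (F t) (X (γ t))) ∧
      (∀ t, ∀ᶠ v in 𝓝 (γ t), F t (X v) = Y v) ∧
      ∀ t, ∀ᶠ t' in 𝓝 t, F t' =ᶠ[𝓝 (X (γ t'))] F t := by
  let F : unitInterval → ℂ → ℂ := fun t =>
    Y ∘ (hX t).hasStrictDerivAt.localInverse _ _ _ (hX' t)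
  have hl : ∀ t, ∀ᶠ v in 𝓝 (γ t), F t (X v) = Y v := fun t => by
    filter_upwards [(hX t).hasStrictDerivAt.eventually_left_inverse (hX' t)] with v hv
    simp only [F, Function.comp, hv]
  refine ⟨F, fun t => ?_, hl, fun t => ?_⟩
  · refine AnalyticAt.comp ?_ ((hX t).analyticAt_localInverse (hX' t))
    rw [((hX t).hasStrictDerivAt.eventually_left_inverse (hX' t)).self_of_nhds]
    exact hY t
  · filter_upwards [γ.continuous.continuousAt.eventually (eventually_eventually_nhds.2 (hl t))]
      with t' ht'
    rw [EventuallyEq, ← (hX t').hasStrictDerivAt.map_nhds_eq (hX' t'), eventually_map]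
    filter_upwards [ht', hl t'] with v h1 h2
    rw [h1, h2]

/-! ### Closed solutions -/

/-- The solution curve through `(0, z)`, parametrized by `v = x y`: its `y`-coordinate. -/
noncomputable def curveY (n : ℕ) (z v : ℂ) : ℂ :=
  z * secondFactor n v ^ (n + 1) / firstFactor n v ^ n

/-- The solution curve through `(0, z)`, parametrized by `v = x y`: its `x`-coordinate. -/
noncomputable def curveX (n : ℕ) (z v : ℂ) : ℂ := v / curveY n z v

lemma curveY_ne_zero {n : ℕ} {z v : ℂ} (hz : z ≠ 0) (hA : firstFactor n v ≠ 0)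
    (hD : secondFactor n v ≠ 0) : curveY n z v ≠ 0 :=
  div_ne_zero (mul_ne_zero hz (pow_ne_zero _ hD)) (pow_ne_zero _ hA)

lemma analyticAt_curveY {n : ℕ} {z v : ℂ} (hA : firstFactor n v ≠ 0) :
    AnalyticAt ℂ (curveY n z) v :=
  (analyticAt_const.mul ((analyticAt_secondFactor n v).pow _)).div
    ((analyticAt_firstFactor n v).pow _) (pow_ne_zero _ hA)

lemma analyticAt_curveX {n : ℕ} {z v : ℂ} (hz : z ≠ 0) (hA : firstFactor n v ≠ 0)
    (hD : secondFactor n v ≠ 0) : AnalyticAt ℂ (curveX n z) v :=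
  analyticAt_id.div (analyticAt_curveY hA) (curveY_ne_zero hz hA hD)

lemma hasDerivAt_curveY {n : ℕ} (hn : 1 ≤ n) {z v : ℂ} (hA : firstFactor n v ≠ 0)
    (hD : secondFactor n v ≠ 0) :
    HasDerivAt (curveY n z)
      (curveY n z v * (abelC n * v + 1) / (firstFactor n v * secondFactor n v)) v := by
  have h := (((hasDerivAt_secondFactor hn v).pow (n + 1)).const_mul z).div
    ((hasDerivAt_firstFactor hn v).pow n) (pow_ne_zero n hA)
  refine h.congr_deriv ?_
  rw [abelC_mul_add_one hn, curveY]
  have h2 := two_mul_natCast_add_one_ne_zero n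
  obtain ⟨m, rfl⟩ : ∃ m, n = m + 1 := ⟨n - 1, by omega⟩
  rw [Nat.cast_succ (m + 1)]
  simp only [Pi.pow_apply, Nat.add_sub_cancel]
  generalize (2 * ((m + 1 : ℕ) : ℂ) + 1) = M at *
  generalize ((m + 1 : ℕ) : ℂ) = N at *
  generalize firstFactor (m + 1) v = A at *
  generalize secondFactor (m + 1) v = D at *
  field_simp
  ring

lemma hasDerivAt_curveX {n : ℕ} (hn : 1 ≤ n) {z v : ℂ} (hz : z ≠ 0) (hA : firstFactor n v ≠ 0)
    (hD : secondFactor n v ≠ 0) :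
    HasDerivAt (curveX n z) (1 / (curveY n z v * firstFactor n v * secondFactor n v)) v := by
  have hY := curveY_ne_zero hz hA hD
  have h := (hasDerivAt_id v).div (hasDerivAt_curveY (z := z) hn hA hD) hY
  refine h.congr_deriv ?_
  have hne := mul_ne_zero hA hD
  rw [mul_assoc (curveY n z v)]
  have hQ := firstFactor_mul_secondFactor hn v
  simp only [id]
  generalize firstFactor n v * secondFactor n v = Q at *
  field_simp
  linear_combination hQ

lemma exists_path_factors_ne_zero {n : ℕ} (hn : 1 ≤ n) {w : ℂ} (hA : firstFactor n w ≠ 0)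
    (hD : secondFactor n w ≠ 0) :
    ∃ γ : Path (0 : ℂ) w, ∀ t, firstFactor n (γ t) ≠ 0 ∧ secondFactor n (γ t) ≠ 0 := by
  have h2 := two_mul_natCast_add_one_ne_zero n
  have h0 : (n : ℂ) ≠ 0 := by exact_mod_cast (by omega : n ≠ 0)
  have h1 : (n + 1 : ℂ) ≠ 0 := by exact_mod_cast Nat.succ_ne_zero n
  let S : Set ℂ := {v | firstFactor n v = 0 ∨ secondFactor n v = 0}
  have hS : S.Countable := by
    refine (Set.toFinite ({-((2 * n + 1) / n : ℂ), -((2 * n + 1) / (n + 1) : ℂ)} : Set ℂ)).countable.mono ?_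
    rintro v (hv | hv)
    · left
      rw [firstFactor_eq hn] at hv
      generalize (2 * n + 1 : ℂ) = M at *
      field_simp at hv ⊢
      linear_combination hv
    · right
      rw [secondFactor_eq hn] at hv
      rw [Set.mem_singleton_iff]
      generalize (2 * n + 1 : ℂ) = M at *
      field_simp at hv ⊢
      linear_combination hv
  have hpc := hS.isPathConnected_compl_of_one_lt_rank
    (by rw [Complex.rank_real_complex]; exact Nat.one_lt_ofNat)
  obtain ⟨γ, hγ⟩ := hpc.joinedIn 0 (by simp [S, firstFactor_zero, secondFactor_zero]) w
    (by simp [S, hA, hD])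
  exact ⟨γ, fun t => by simpa [S] using hγ t⟩

/-- In the parameter `v = x y` the endpoint `(b, z)` corresponds to `v = b z`, and the path has
to avoid only the zeros of the two factors. -/
lemma exists_closed_solution {n : ℕ} (hn : 1 ≤ n) {b z : ℂ} (hz : z ≠ 0)
    (h : firstFactor n (b * z) ^ n = secondFactor n (b * z) ^ (n + 1)) :
    ∃ (y : ℂ → ℂ) (s : Path (0 : ℂ) b),
      y 0 = z ∧ IsLocalSolution (abelC n) 0 y ∧ ClosesAlong y s := by
  obtain ⟨hAb, hDb⟩ := factors_ne_zero_of_pow_eq hn h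
  obtain ⟨γ, hγ⟩ := exists_path_factors_ne_zero hn hAb hDb
  have hX : ∀ t, AnalyticAt ℂ (curveX n z) (γ t) := fun t =>
    analyticAt_curveX hz (hγ t).1 (hγ t).2
  have hX' : ∀ t, deriv (curveX n z) (γ t) ≠ 0 := fun t => by
    rw [(hasDerivAt_curveX hn hz (hγ t).1 (hγ t).2).deriv]
    exact one_div_ne_zero
      (mul_ne_zero (mul_ne_zero (curveY_ne_zero hz (hγ t).1 (hγ t).2) (hγ t).1) (hγ t).2)
  obtain ⟨F, hFa, hFl, hFc⟩ := exists_germs_of_parametrization γ hX hX'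
    (fun t => analyticAt_curveY (z := z) (hγ t).1)
  have hX0 : curveX n z 0 = 0 := by simp [curveX]
  have hY0 : curveY n z 0 = z := by simp [curveY, firstFactor_zero, secondFactor_zero]
  have hYb : curveY n z (b * z) = z := by
    rw [curveY, ← h, mul_div_cancel_right₀ _ (pow_ne_zero _ hAb)]
  have hXb : curveX n z (b * z) = b := by rw [curveX, hYb, mul_div_cancel_right₀ _ hz]
  let s : Path (0 : ℂ) b :=
    { toFun := fun t => curveX n z (γ t)
      continuous_toFun := continuous_iff_continuousAt.2 fun t =>
        (hX t).continuousAt.comp γ.continuous.continuousAt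
      source' := by simp only [γ.source, hX0]
      target' := by simp only [γ.target, hXb] }
  have hF0 : F 0 0 = z := by
    have := (hFl 0).self_of_nhds
    rwa [γ.source, hX0, hY0] at this
  have hF1 : F 1 b = z := by
    have := (hFl 1).self_of_nhds
    rwa [γ.target, hXb, hYb] at this
  refine ⟨F 0, s, hF0, ?_, F, ⟨hFa, EventuallyEq.rfl, hFc⟩, by rw [hF1, hF0]⟩
  -- The equation is checked at `x = x(v)` for small `v`, by the chain rule:
  -- the neighbourhoods of `0` are the images under `x = x(v)` of those of the parameter `0`.
  have hmap := (hX 0).hasStrictDerivAt.map_nhds_eq (hX' 0)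
  have ha := (hFa 0).eventually_analyticAt
  rw [← hmap, eventually_map] at ha
  have hl := hFl 0
  rw [γ.source] at hmap ha hl
  rw [hX0] at hmap
  rw [IsLocalSolution, ← hmap, eventually_map]
  have hA : ∀ᶠ v in 𝓝 0, firstFactor n v ≠ 0 :=
    (analyticAt_firstFactor n 0).continuousAt.eventually_ne (by simp [firstFactor_zero])
  have hD : ∀ᶠ v in 𝓝 0, secondFactor n v ≠ 0 :=
    (analyticAt_secondFactor n 0).continuousAt.eventually_ne (by simp [secondFactor_zero])
  filter_upwards [ha, eventually_eventually_nhds.2 hl, hA, hD] with v hav hlv hAv hDv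
  have hY := curveY_ne_zero (n := n) hz hAv hDv
  have hcomp := hav.differentiableAt.hasDerivAt.comp v (hasDerivAt_curveX hn hz hAv hDv)
  have hchain := (hcomp.congr_of_eventuallyEq (f₁ := curveY n z)
    (hlv.mono fun _ hx => hx.symm)).unique (hasDerivAt_curveY hn hAv hDv)
  have hxv : curveX n z v * curveY n z v = v := div_mul_cancel₀ _ hY
  refine hav.differentiableAt.hasDerivAt.congr_deriv ?_
  rw [hlv.self_of_nhds]
  have e : deriv (F 0) (curveX n z v) = curveY n z v ^ 2 * (abelC n * v + 1) := by
    field_simp at hchain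
    linear_combination hchain
  rw [e]
  linear_combination -abelC n * curveY n z v ^ 2 * hxv

/-! ### The number of roots -/

/-- The polynomial in `z` whose roots are the solutions of
`(1 - b z / v₁) ^ n = (1 - b z / v₂) ^ (n + 1)`. -/
noncomputable def closingPolynomial (n : ℕ) (b : ℂ) : ℂ[X] :=
  (C (n / (2 * n + 1) * b) * X + C 1) ^ n - (C ((n + 1) / (2 * n + 1) * b) * X + C 1) ^ (n + 1)

lemma eval_closingPolynomial {n : ℕ} (hn : 1 ≤ n) (b z : ℂ) :
    (closingPolynomial n b).eval z =
      firstFactor n (b * z) ^ n - secondFactor n (b * z) ^ (n + 1) := by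
  rw [firstFactor_eq hn, secondFactor_eq hn, closingPolynomial]
  simp only [eval_sub, eval_pow, eval_add, eval_mul, eval_C, eval_X]
  ring

lemma natDegree_closingPolynomial (n : ℕ) {b : ℂ} (hb : b ≠ 0) :
    (closingPolynomial n b).natDegree = n + 1 := by
  have h2 := two_mul_natCast_add_one_ne_zero n
  have h1 : (n + 1 : ℂ) ≠ 0 := by exact_mod_cast Nat.succ_ne_zero n
  have hd : ((C ((n + 1) / (2 * n + 1) * b) * X + C 1 : ℂ[X]) ^ (n + 1)).natDegree = n + 1 := by
    rw [natDegree_pow, natDegree_linear (mul_ne_zero (div_ne_zero h1 h2) hb), mul_one]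
  have ha : ((C (n / (2 * n + 1) * b) * X + C 1 : ℂ[X]) ^ n).natDegree ≤ n := by
    refine natDegree_pow_le.trans ?_
    simpa using Nat.mul_le_mul_left n (natDegree_linear_le (a := (n / (2 * n + 1) * b : ℂ)) (b := 1))
  rw [closingPolynomial, natDegree_sub_eq_right_of_natDegree_lt (by omega), hd]

/-- A double root would give `d = -(n + 1) / n` and `a = -n / (n + 1)`, so `|a| < 1 < |d|`,
against `a ^ n = d ^ (n + 1)`. -/
lemma not_isRoot_derivative_closingPolynomial {n : ℕ} (hn : 1 ≤ n) {b z : ℂ} (hb : b ≠ 0)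
    (h : (closingPolynomial n b).IsRoot z) :
    ¬ (derivative (closingPolynomial n b)).IsRoot z := by
  intro h'
  have h2 := two_mul_natCast_add_one_ne_zero n
  have h0 : (n : ℂ) ≠ 0 := by exact_mod_cast (by omega : n ≠ 0)
  have h1 : (n + 1 : ℂ) ≠ 0 := by exact_mod_cast Nat.succ_ne_zero n
  rw [IsRoot.def, eval_closingPolynomial hn, sub_eq_zero] at h
  obtain ⟨hA, hD⟩ := factors_ne_zero_of_pow_eq hn h
  have hr := firstFactor_secondFactor_relation hn (b * z)
  have hd : n * firstFactor n (b * z) ^ (n - 1) * (n / (2 * n + 1) * b) -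
      (n + 1) * secondFactor n (b * z) ^ n * ((n + 1) / (2 * n + 1) * b) = 0 := by
    rw [firstFactor_eq hn, secondFactor_eq hn]
    rw [IsRoot.def, closingPolynomial] at h'
    simp [derivative_pow] at h'
    linear_combination h'
  generalize firstFactor n (b * z) = A at *
  generalize secondFactor n (b * z) = D at *
  have hd' : (n : ℂ) ^ 2 * D = (n + 1) ^ 2 * A := by
    have e : A ^ n = A ^ (n - 1) * A := by rw [← pow_succ, Nat.sub_add_cancel hn]
    have : D ^ n * ((n : ℂ) ^ 2 * D) = D ^ n * ((n + 1) ^ 2 * A) := by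
      have hd2 : (n : ℂ) ^ 2 * A ^ (n - 1) - (n + 1) ^ 2 * D ^ n = 0 := by
        refine (mul_eq_zero.1 ?_).resolve_right (div_ne_zero hb h2)
        linear_combination hd
      have e' := h
      rw [e, pow_succ] at e'
      linear_combination A * hd2 - (n : ℂ) ^ 2 * e'
    exact mul_left_cancel₀ (pow_ne_zero _ hD) this
  have hDv : D = -((n + 1) / n) := by
    field_simp
    linear_combination (-(n + 1 : ℂ)) * hr - hd'
  have hAv : A = -(n / (n + 1)) := by
    rw [hDv] at hr
    field_simp at hr ⊢
    linear_combination hr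
  have hn' : (0 : ℝ) < n := by exact_mod_cast hn
  have hnormA : ‖A‖ < 1 := by
    rw [hAv, norm_neg, norm_div, Complex.norm_natCast, ← Nat.cast_succ, Complex.norm_natCast,
      div_lt_one (by positivity)]
    push_cast
    linarith
  have hnormD : 1 < ‖D‖ := by
    rw [hDv, norm_neg, norm_div, Complex.norm_natCast, ← Nat.cast_succ, Complex.norm_natCast,
      one_lt_div hn']
    push_cast
    linarith
  have hlt : ‖A ^ n‖ < 1 := by
    rw [norm_pow]
    exact pow_lt_one₀ (norm_nonneg _) hnormA (by omega)
  have hgt : 1 < ‖D ^ (n + 1)‖ := by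
    rw [norm_pow]
    exact one_lt_pow₀ hnormD n.succ_ne_zero
  rw [h] at hlt
  exact lt_asymm hlt hgt

lemma ncard_nonzero_roots {n : ℕ} (hn : 1 ≤ n) {b : ℂ} (hb : b ≠ 0) :
    {z : ℂ | z ≠ 0 ∧ firstFactor n (b * z) ^ n = secondFactor n (b * z) ^ (n + 1)}.ncard = n := by
  classical
  have hdeg := natDegree_closingPolynomial n hb
  have hp : closingPolynomial n b ≠ 0 := ne_zero_of_natDegree_gt (n := 0) (by omega)
  have hnodup : (closingPolynomial n b).roots.Nodup := by
    rw [Multiset.nodup_iff_count_le_one]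
    intro z
    rw [count_roots]
    by_contra! hlt
    obtain ⟨h, h'⟩ := (one_lt_rootMultiplicity_iff_isRoot hp).1 hlt
    exact not_isRoot_derivative_closingPolynomial hn hb h h'
  have hcard : (closingPolynomial n b).roots.toFinset.card = n + 1 := by
    rw [Multiset.toFinset_card_of_nodup hnodup, IsAlgClosed.card_roots_eq_natDegree, hdeg]
  have hset : {z : ℂ | z ≠ 0 ∧ firstFactor n (b * z) ^ n = secondFactor n (b * z) ^ (n + 1)} =
      ((closingPolynomial n b).roots.toFinset.erase 0 : Finset ℂ) := by
    ext z
    simp [hp, IsRoot.def, eval_closingPolynomial hn, sub_eq_zero, and_comm]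
  rw [hset, Set.ncard_coe_finset, Finset.card_erase_of_mem, hcard, Nat.add_sub_cancel]
  simp [hp, IsRoot.def, eval_closingPolynomial hn, firstFactor_zero, secondFactor_zero]

/-! ### The closed solutions and their initial values -/

theorem theorem5p1 (n : ℕ) (hn : 1 ≤ n) (b : ℂ) (hb : b ≠ 0) :
    (∃ (y : Fin n → ℂ → ℂ) (s : Fin n → Path (0 : ℂ) b),
      Function.Injective (fun j => y j 0) ∧
      Set.range (fun j => y j 0) =
        {z : ℂ | z ≠ 0 ∧ (1 - b * z / abelV₁ n) ^ n = (1 - b * z / abelV₂ n) ^ (n + 1)} ∧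
      ∀ j, IsLocalSolution (abelC n) 0 (y j) ∧ ClosesAlong (y j) (s j)) ∧
    (∀ (y : ℂ → ℂ) (s : Path (0 : ℂ) b),
      IsLocalSolution (abelC n) 0 y → ClosesAlong y s → y 0 ≠ 0 →
        (1 - b * y 0 / abelV₁ n) ^ n = (1 - b * y 0 / abelV₂ n) ^ (n + 1)) := by
  refine ⟨?_, fun y s hy hc h0 => pow_eq_of_closesAlong hn hy hc h0⟩
  have hcard := ncard_nonzero_roots hn hb
  change ∃ (y : Fin n → ℂ → ℂ) (s : Fin n → Path (0 : ℂ) b), _ ∧ _ = {z : ℂ | z ≠ 0 ∧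
    firstFactor n (b * z) ^ n = secondFactor n (b * z) ^ (n + 1)} ∧ _
  set S := {z : ℂ | z ≠ 0 ∧ firstFactor n (b * z) ^ n = secondFactor n (b * z) ^ (n + 1)}
  have hfin : Finite S := Set.finite_of_ncard_pos (by omega)
  let e : Fin n ≃ S := (Finite.equivFinOfCardEq hcard).symm
  choose y s hy0 hy hc using fun j => exists_closed_solution hn (e j).2.1 (e j).2.2
  refine ⟨y, s, ?_, ?_, fun j => ⟨hy j, hc j⟩⟩
  · simp only [hy0]
    exact Subtype.val_injective.comp e.injective
  · simp only [hy0]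
    rw [← Function.comp_def, e.surjective.range_comp, Subtype.range_coe]
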